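/- Let $V$ be a complex manifold of dimension $n$ with a Ricci-flat Kähler metric $g$, written in local holomorphic coordinates as $(g_{i\bar j})$, with fundamental form $\omega=\frac{\sqrt{-1}}{2}\sum g_{i\bar j}\,dz_i\wedge d\bar z_j$ and inverse $(g^{i\bar j})$. For a $(1,1)$-form $\varphi=\sum\varphi_{i\bar j}\,dz_i\wedge d\bar z_j$ (possibly with values in a bundle) put $\sqrt{-1}\Lambda_g\varphi=2\sum g^{i\bar j}\varphi_{i\bar j}$, and for a smooth function $f$ put $\Delta_g f=\sqrt{-1}\Lambda_g\partial\bar\partial f=2\sum g^{i\bar j}\frac{\partial^2 f}{\partial z_i\partial\bar z_j}$. Let $\mathcal F$ be a trivial holomorphic vector bundle of rank $r$ over $V$ and $H$ a smooth Hermitian metric on $\mathcal F$. Fix a holomorphic trivialization of $\mathcal F$ and view $H$ as the function on $V$ with values in positive definite Hermitian $r\times r$ matrices, $H=(H_{\alpha\bar\beta})$ with $H_{\alpha\bar\beta}=\langle s_\alpha,s_\beta\rangle_H$ for the corresponding holomorphic frame $s_1,\dots,s_r$, so that the Chern connection of $H$ is $d+\partial H H^{-1}$ with curvature $F_H=\bar\partial(\partial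 H H^{-1})$. Suppose that $H$ is Hermitian-Yang-Mills with respect to $g$, i.e. $\sqrt{-1}\Lambda_g F_H=\lambda I$ for some constant $\lambda$. Write $\partial H H^{-1}=\sum_k A_k\,dz_k$ in local coordinates and let $$|\partial H H^{-1}|^2_{H,g}=\sum_{k,l} g^{k\bar l}\,\mathrm{tr}\bigl(A_k\,H A_l^{*}H^{-1}\bigr)$$ be the squared pointwise norm of this endomorphism-valued $(1,0)$-form, where $A_l^*$ is the conjugate transpose. Then on all of $V$ $$-\Delta_g\,|\partial H H^{-1}|^2_{H,g}\le 0 .$$ -/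

import Mathlib

open scoped Manifold ContDiff Matrix ComplexOrder

noncomputable section

namespace KahlerHYM

/-- The model space `ℂⁿ` of an `n`-dimensional complex manifold. -/
abbrev Cn (n : ℕ) : Type := EuclideanSpace ℂ (Fin n)

/-- The Wirtinger derivative `∂f/∂zᵢ = (∂f/∂xᵢ - √-1 ∂f/∂yᵢ) / 2`. -/
def dz {n : ℕ} (i : Fin n) (f : Cn n → ℂ) (z : Cn n) : ℂ :=
  (fderiv ℝ f z (EuclideanSpace.single i 1)
    - Complex.I * fderiv ℝ f z (EuclideanSpace.single i Complex.I)) / 2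

/-- The Wirtinger derivative `∂f/∂z̄ᵢ = (∂f/∂xᵢ + √-1 ∂f/∂yᵢ) / 2`. -/
def dzbar {n : ℕ} (i : Fin n) (f : Cn n → ℂ) (z : Cn n) : ℂ :=
  (fderiv ℝ f z (EuclideanSpace.single i 1)
    + Complex.I * fderiv ℝ f z (EuclideanSpace.single i Complex.I)) / 2

section Manifold

variable {n r : ℕ} {V : Type*} [TopologicalSpace V] [ChartedSpace (Cn n) V]

/-- The coordinate tangent vector `∂/∂zᵢ` of the holomorphic chart `e`, at the point of `V` with
coordinates `z`. -/
def coordVec (e : OpenPartialHomeomorph V (Cn n)) (z : Cn n) (i : Fin n) :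
    TangentSpace 𝓘(ℂ, Cn n) (e.symm z) :=
  mfderiv 𝓘(ℂ, Cn n) 𝓘(ℂ, Cn n) e.symm z (EuclideanSpace.single i (1 : ℂ) : Cn n)

variable (n V) in
/-- A smooth Hermitian metric on (the holomorphic tangent bundle of) a complex manifold: a positive
definite Hermitian form on each tangent space, linear in the first and conjugate-linear in the
second variable, whose coefficients in holomorphic charts are `C^∞` in the real sense. -/
structure HermitianMetric where
  form : ∀ x : V, TangentSpace 𝓘(ℂ, Cn n) x →ₗ[ℂ]
    TangentSpace 𝓘(ℂ, Cn n) x →ₛₗ[starRingEnd ℂ] ℂ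
  conj_symm : ∀ (x : V) (v w : TangentSpace 𝓘(ℂ, Cn n) x),
    starRingEnd ℂ (form x v w) = form x w v
  pos : ∀ (x : V) (v : TangentSpace 𝓘(ℂ, Cn n) x), v ≠ 0 → 0 < (form x v v).re
  smooth : ∀ e ∈ IsManifold.maximalAtlas 𝓘(ℂ, Cn n) ω V, ∀ i j : Fin n,
    ContDiffOn ℝ ∞ (fun z => form (e.symm z) (coordVec e z i) (coordVec e z j)) e.target

namespace HermitianMetric

variable (g : HermitianMetric n V)

/-- The coefficients `g_{i j̄} = g(∂/∂zᵢ, ∂/∂zⱼ)` in the chart `e`. The fundamental form of the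
metric is `(√-1 / 2) ∑ g_{i j̄} dzᵢ ∧ dz̄ⱼ`. -/
def coeff (e : OpenPartialHomeomorph V (Cn n)) (z : Cn n) : Matrix (Fin n) (Fin n) ℂ :=
  Matrix.of fun i j => g.form (e.symm z) (coordVec e z i) (coordVec e z j)

/-- The inverse coefficients `g^{i j̄}`, normalized by `∑ⱼ g^{i j̄} g_{k j̄} = δᵢₖ`. -/
def invCoeff (e : OpenPartialHomeomorph V (Cn n)) (z : Cn n) (i j : Fin n) : ℂ :=
  (g.coeff e z)⁻¹ j i

/-- The metric is Kähler: its fundamental form is closed, which in holomorphic coordinates reads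
`∂g_{i j̄}/∂z_k = ∂g_{k j̄}/∂zᵢ` (the `(2,1)`-part of `dω = 0`; the `(1,2)`-part is its complex
conjugate). -/
def IsKahler : Prop :=
  ∀ e ∈ IsManifold.maximalAtlas 𝓘(ℂ, Cn n) ω V, ∀ z ∈ e.target, ∀ i j k : Fin n,
    dz k (fun w => g.coeff e w i j) z = dz i (fun w => g.coeff e w k j) z

/-- The Christoffel symbols `Γ^i_{kq} = ∑ₚ g^{i p̄} ∂g_{q p̄}/∂z_k` of the Chern connection of the
metric, which is the Levi-Civita connection if the metric is Kähler. -/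
def christoffel (e : OpenPartialHomeomorph V (Cn n)) (z : Cn n) (i k q : Fin n) : ℂ :=
  ∑ p, g.invCoeff e z i p * dz k (fun w => g.coeff e w q p) z

/-- The components `R^i_{q k j̄} = -∂Γ^i_{kq}/∂z̄ⱼ` of the curvature tensor. -/
def curvature (e : OpenPartialHomeomorph V (Cn n)) (z : Cn n) (i q k j : Fin n) : ℂ :=
  -dzbar j (fun w => g.christoffel e w i k q) z

/-- The Ricci tensor `R_{k j̄} = ∑ᵢ R^i_{i k j̄}`. -/
def ricci (e : OpenPartialHomeomorph V (Cn n)) (z : Cn n) (k j : Fin n) : ℂ :=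
  ∑ i, g.curvature e z i i k j

/-- The metric is Ricci-flat. -/
def IsRicciFlat : Prop :=
  ∀ e ∈ IsManifold.maximalAtlas 𝓘(ℂ, Cn n) ω V, ∀ z ∈ e.target, ∀ k j : Fin n,
    g.ricci e z k j = 0

/-- The contraction `√-1 Λ_g φ = 2 ∑ g^{i j̄} φ_{i j̄}` of a `(1,1)`-form
`φ = ∑ φ_{i j̄} dzᵢ ∧ dz̄ⱼ` with values in a complex vector space. -/
def iLambda {W : Type*} [AddCommGroup W] [Module ℂ W]
    (e : OpenPartialHomeomorph V (Cn n)) (z : Cn n) (φ : Fin n → Fin n → W) : W :=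
  ∑ i, ∑ j, (2 * g.invCoeff e z i j) • φ i j

/-- The Laplacian `Δ_g f = √-1 Λ_g ∂∂̄f = 2 ∑ g^{i j̄} ∂²f/∂zᵢ∂z̄ⱼ` of a real function `f` on `V`,
in the chart `e`; the sum is real when `f` is twice continuously differentiable. -/
def laplacian (f : V → ℝ) (e : OpenPartialHomeomorph V (Cn n)) (z : Cn n) : ℝ :=
  (g.iLambda e z fun i j => dz i (fun w => dzbar j (fun u => (f (e.symm u) : ℂ)) w) z).re

end HermitianMetric

variable (n r V) in
/-- A smooth Hermitian metric on the trivial holomorphic bundle `V × ℂ^r`, as the matrix-valued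
function `H_{α β̄} = ⟨s_α, s_β⟩` on `V` formed in the standard holomorphic frame `s_1, …, s_r`. -/
structure BundleMetric where
  mat : V → Matrix (Fin r) (Fin r) ℂ
  posDef : ∀ x, (mat x).PosDef
  smooth : ∀ α β : Fin r, ContMDiff 𝓘(ℝ, Cn n) 𝓘(ℝ, ℂ) ∞ fun x => mat x α β

namespace BundleMetric

variable (H : BundleMetric n r V)

/-- The matrix-valued `(1,0)`-form `∂H`: `∂H(v) = (dH(v) - √-1 dH(√-1 v)) / 2`. -/
def del (x : V) (v : TangentSpace 𝓘(ℂ, Cn n) x) : Matrix (Fin r) (Fin r) ℂ :=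
  Matrix.of fun α β =>
    let dH : Cn n → ℂ := fun w => mfderiv 𝓘(ℝ, Cn n) 𝓘(ℝ, ℂ) (fun y => H.mat y α β) x w
    (dH v - Complex.I * dH (Complex.I • v)) / 2

/-- The connection form `A = ∂H H⁻¹` of the Chern connection of `H`. -/
def connForm (x : V) (v : TangentSpace 𝓘(ℂ, Cn n) x) : Matrix (Fin r) (Fin r) ℂ :=
  H.del x v * (H.mat x)⁻¹

/-- The curvature `F_H = ∂̄(∂H H⁻¹)` of the Chern connection in the chart `e`: the coefficient of
`dzᵢ ∧ dz̄ⱼ` is `-∂Aᵢ/∂z̄ⱼ`, where `Aᵢ = A(∂/∂zᵢ)`. -/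
def curvature (e : OpenPartialHomeomorph V (Cn n)) (z : Cn n) (i j : Fin n) :
    Matrix (Fin r) (Fin r) ℂ :=
  Matrix.of fun α β => -dzbar j (fun w => H.connForm (e.symm w) (coordVec e w i) α β) z

/-- The Hermitian-Yang-Mills equation `√-1 Λ_g F_H = lam • I` for some constant `lam`. -/
def IsHYM (g : HermitianMetric n V) : Prop :=
  ∃ lam : ℂ, ∀ e ∈ IsManifold.maximalAtlas 𝓘(ℂ, Cn n) ω V, ∀ z ∈ e.target,
    g.iLambda e z (H.curvature e z) = lam • (1 : Matrix (Fin r) (Fin r) ℂ)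

/-- The pairing `⟨a, b⟩_H = tr(a b^{*_H})` of endomorphisms, `b^{*_H} = H b^* H⁻¹`. -/
def inner (x : V) (a b : Matrix (Fin r) (Fin r) ℂ) : ℂ :=
  (a * (H.mat x * bᴴ * (H.mat x)⁻¹)).trace

/-- The function `|∂H H⁻¹|²_{H,g}` on `V`: the squared norm, with respect to `g` and `H`, of the
endomorphism-valued `(1,0)`-form `A = ∂H H⁻¹`, that is `∑ g^{k l̄} ⟨A(e_k), A(e_l)⟩_H` for a basis
`e_1, …, e_n` of the tangent space at `x` (any basis gives the same value). -/
def normSqConnForm (g : HermitianMetric n V) (x : V) : ℝ :=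
  let b : Fin n → TangentSpace 𝓘(ℂ, Cn n) x := fun k => (EuclideanSpace.single k 1 : Cn n)
  let G : Matrix (Fin n) (Fin n) ℂ := Matrix.of fun k l => g.form x (b k) (b l)
  (∑ k, ∑ l, G⁻¹ l k * H.inner x (H.connForm x (b k)) (H.connForm x (b l))).re

end BundleMetric

end Manifold

end KahlerHYM

end

/-! This is a Bochner argument. Write `A` for `∂H H⁻¹`. The frame is fixed, so `A` is an
endomorphism-valued `(1,0)`-form, and it can be differentiated covariantly with the Chern
connections of `g` and `H`. Metric compatibility expands the contracted `∂ᵢ∂_j̄ |A|²` into four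
terms: `|∇^{0,1}A|²`, `|∇^{1,0}A|²`, and pairings of `A` with the contracted second derivatives
`∇ᵢ∇_j̄ A` and `∇_j̄∇ᵢ A`.

Both second-order terms vanish. For the first (`sum_cov_bar_A`), differentiate the
Hermitian-Yang-Mills equation: `∂̄A` is the curvature of `H`, and because the `(2,0)`-curvature and
the torsion of `g` vanish, the derivative of its contraction is the contracted `∇ᵢ∇_j̄ A`. The
second (`sum_bar_cov_A`) differs from the first by the Ricci curvature acting on `A` and by the
commutator of `A` with the scalar mean curvature; both are zero. Thus `bochner` leaves two squared
norms, which are nonnegative.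

The identities are proved over an abstract commutative ring with commuting derivations and a star.
They are then applied to the smooth functions on the target of a chart and evaluated at a point. -/

namespace KahlerHYM

/-! ### Chern connections and Kähler symmetries over a ring with derivations. -/

section Algebra

variable {ι κ R : Type*} [Fintype ι] [DecidableEq ι] [Fintype κ] [DecidableEq κ]
  [CommRing R] [Algebra ℂ R]

theorem matrix_map_derivation_mul {l m n : Type*} [Fintype m] (D : Derivation ℂ R R)
    (M : Matrix l m R) (N : Matrix m n R) :
    (M * N).map D = M.map D * N + M * N.map D := by
  ext i j
  simp only [Matrix.map_apply, Matrix.mul_apply, Matrix.add_apply, map_sum, Derivation.leibniz,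
    smul_eq_mul, ← Finset.sum_add_distrib]
  exact Finset.sum_congr rfl fun k _ => by ring

omit [Fintype ι] in
theorem matrix_map_derivation_one (D : Derivation ℂ R R) :
    (1 : Matrix ι ι R).map D = 0 := by
  ext i j
  by_cases hij : i = j <;> simp [hij]

omit [DecidableEq ι] in
theorem trace_map_derivation (D : Derivation ℂ R R) (M : Matrix ι ι R) :
    (M.map D).trace = D M.trace := by
  simp [Matrix.trace]

theorem matrix_map_derivation_inv (D : Derivation ℂ R R) {M N : Matrix ι ι R} (h : M * N = 1) :
    N.map D = -(N * (M.map D * N)) := by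
  have h' : N * M = 1 := mul_eq_one_comm.mp h
  have h1 := matrix_map_derivation_mul D M N
  rw [h, matrix_map_derivation_one] at h1
  have h2 : M * N.map D = -(M.map D * N) := by
    rw [eq_neg_iff_add_eq_zero, add_comm]; exact h1.symm
  calc N.map D = N * (M * N.map D) := by rw [← mul_assoc, h', one_mul]
    _ = _ := by rw [h2, mul_neg]

variable [StarRing R]

variable (ι κ R) in
/-- A Kähler metric `G` and a bundle metric `h` in local coordinates, over a ring `R` of functions
with commuting derivations `∂/∂zᵢ` and `∂/∂z̄ᵢ`; `Gi` and `hi` are the inverse matrices. -/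
structure LocalMetrics where
  d : ι → Derivation ℂ R R
  db : ι → Derivation ℂ R R
  star_d : ∀ i f, star (d i f) = db i (star f)
  d_comm : ∀ i j f, d i (d j f) = d j (d i f)
  d_db_comm : ∀ i j f, d i (db j f) = db j (d i f)
  G : Matrix ι ι R
  Gi : Matrix ι ι R
  G_herm : Gᴴ = G
  G_mul : G * Gi = 1
  h : Matrix κ κ R
  hi : Matrix κ κ R
  h_herm : hᴴ = h
  h_mul : h * hi = 1
  kahler : ∀ i j k, d k (G i j) = d i (G k j)

namespace LocalMetrics

variable (S : LocalMetrics ι κ R)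

/-- The connection form of the Chern connection of `h`. -/
def A (k : ι) : Matrix κ κ R := S.h.map (S.d k) * S.hi

/-- The connection form of the Chern connection of `G`. -/
def Th (k : ι) : Matrix ι ι R := S.G.map (S.d k) * S.Gi

/-- The `(1,0)`-part of the covariant derivative of an endomorphism-valued `(1,0)`-form. -/
def cov (i : ι) (B : ι → Matrix κ κ R) (k : ι) : Matrix κ κ R :=
  (B k).map (S.d i) - ∑ m, S.Th i k m • B m - S.A i * B k + B k * S.A i

/-- The `(0,1)`-part of the covariant derivative of an endomorphism-valued `(1,0)`-form. -/
def bar (j : ι) (B : ι → Matrix κ κ R) (k : ι) : Matrix κ κ R := (B k).map (S.db j)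

/-- The pointwise inner product of endomorphism-valued `(1,0)`-forms. -/
def pair (B C : ι → Matrix κ κ R) : R :=
  ∑ k, ∑ l, S.Gi l k * (B k * S.h * (C l)ᴴ * S.hi).trace

omit [Algebra ℂ R] in
theorem inv_herm {ι : Type*} [Fintype ι] [DecidableEq ι] {M N : Matrix ι ι R}
    (hM : Mᴴ = M) (h : M * N = 1) : Nᴴ = N := by
  have h1 : Nᴴ * M = 1 := by
    have := congrArg Matrix.conjTranspose h
    rwa [Matrix.conjTranspose_mul, hM, Matrix.conjTranspose_one] at this
  calc Nᴴ = Nᴴ * (M * N) := by rw [h, mul_one]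
    _ = N := by rw [← mul_assoc, h1, one_mul]

theorem Gi_herm : S.Giᴴ = S.Gi := inv_herm S.G_herm S.G_mul
theorem hi_herm : S.hiᴴ = S.hi := inv_herm S.h_herm S.h_mul

theorem star_Gi (i j : ι) : star (S.Gi i j) = S.Gi j i := by
  conv_rhs => rw [← S.Gi_herm]
  rfl

theorem star_G (i j : ι) : star (S.G i j) = S.G j i := by
  conv_rhs => rw [← S.G_herm]
  rfl

theorem star_db (i : ι) (f : R) : star (S.db i f) = S.d i (star f) := by
  rw [← star_star (S.d i (star f)), S.star_d, star_star]

theorem conjTranspose_map_db (i : ι) (M : Matrix κ κ R) :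
    (M.map (S.db i))ᴴ = Mᴴ.map (S.d i) := by
  ext a b; simp [S.star_db]

theorem h_map_d (i : ι) : S.h.map (S.d i) = S.A i * S.h := by
  rw [A, mul_assoc, mul_eq_one_comm.mp S.h_mul, mul_one]

theorem hi_map_d (i : ι) : S.hi.map (S.d i) = -(S.hi * S.A i) :=
  matrix_map_derivation_inv _ S.h_mul

theorem Gi_map_d (i : ι) : S.Gi.map (S.d i) = -(S.Gi * S.Th i) :=
  matrix_map_derivation_inv _ S.G_mul

theorem d_Gi (i l k : ι) : S.d i (S.Gi l k) = -∑ m, S.Gi l m * S.Th i m k := by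
  have := congrFun (congrFun (S.Gi_map_d i) l) k
  simpa [Matrix.mul_apply] using this

theorem star_pair (B C : ι → Matrix κ κ R) : star (S.pair B C) = S.pair C B := by
  simp only [pair, star_sum, star_mul', star_Gi, ← Matrix.trace_conjTranspose,
    Matrix.conjTranspose_mul, Matrix.conjTranspose_conjTranspose, S.h_herm, S.hi_herm]
  rw [Finset.sum_comm]
  refine Finset.sum_congr rfl fun l _ => Finset.sum_congr rfl fun k _ => ?_
  rw [Matrix.trace_mul_comm]
  simp only [mul_assoc]

/-- Differentiating `h` gives `A h` and differentiating `hi` gives `-hi A`; cyclicity of the trace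
gathers these into the commutator of the connection on endomorphisms. The derivative of `Cᴴ` is the
adjoint of the conjugate derivative of `C`. -/
theorem d_trace (i : ι) (B C : Matrix κ κ R) :
    S.d i (B * S.h * Cᴴ * S.hi).trace =
      (((B.map (S.d i) - S.A i * B + B * S.A i)) * S.h * Cᴴ * S.hi).trace +
        (B * S.h * (C.map (S.db i))ᴴ * S.hi).trace := by
  rw [← trace_map_derivation, conjTranspose_map_db]
  simp only [matrix_map_derivation_mul, h_map_d, hi_map_d]
  have h1 : (S.A i * B * S.h * Cᴴ * S.hi).trace = (B * S.h * Cᴴ * (S.hi * S.A i)).trace := by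
    rw [mul_assoc, mul_assoc, mul_assoc, Matrix.trace_mul_comm]
    simp only [mul_assoc]
  simp only [add_mul, sub_mul, mul_neg, Matrix.trace_add, Matrix.trace_sub, Matrix.trace_neg, h1]
  simp only [mul_assoc]
  ring

/-- Metric compatibility of the Chern connections; the Kähler condition plays no role here. -/
theorem d_pair (i : ι) (B C : ι → Matrix κ κ R) :
    S.d i (S.pair B C) = S.pair (S.cov i B) C + S.pair B (S.bar i C) := by
  have h1 : ∀ k l, (S.cov i B k * S.h * (C l)ᴴ * S.hi).trace =
      ((((B k).map (S.d i) - S.A i * B k + B k * S.A i)) * S.h * (C l)ᴴ * S.hi).trace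
      - ∑ m, S.Th i k m * (B m * S.h * (C l)ᴴ * S.hi).trace := by
    intro k l
    rw [cov, sub_right_comm, sub_add_eq_add_sub]
    simp only [sub_mul, Matrix.trace_sub, Finset.sum_mul, Matrix.trace_sum, Matrix.smul_mul,
      Matrix.trace_smul, smul_eq_mul]
  -- After exchanging `k` and `m`, the derivative of the inverse metric is the Christoffel term of
  -- `cov`.
  have h2 : ∑ k, ∑ l, (∑ m, S.Gi l m * S.Th i m k) * (B k * S.h * (C l)ᴴ * S.hi).trace =
      ∑ k, ∑ l, S.Gi l k * ∑ m, S.Th i k m * (B m * S.h * (C l)ᴴ * S.hi).trace := by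
    simp only [Finset.sum_mul, Finset.mul_sum]
    rw [Finset.sum_comm]
    conv_rhs => rw [Finset.sum_comm]
    refine Finset.sum_congr rfl fun l _ => ?_
    rw [Finset.sum_comm]
    exact Finset.sum_congr rfl fun k _ => Finset.sum_congr rfl fun m _ => by ring
  simp only [pair, map_sum, Derivation.leibniz, smul_eq_mul, d_trace, h1, d_Gi, mul_neg, mul_sub,
    mul_add, Finset.sum_add_distrib, Finset.sum_sub_distrib, Finset.sum_neg_distrib, bar]
  rw [← h2]
  simp only [mul_comm]
  ring

theorem db_pair (j : ι) (B C : ι → Matrix κ κ R) :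
    S.db j (S.pair B C) = S.pair (S.bar j B) C + S.pair B (S.cov j C) := by
  rw [← star_pair, ← S.star_d, d_pair, star_add, star_pair, star_pair, add_comm]

theorem d_db_pair (i j : ι) (B : ι → Matrix κ κ R) :
    S.d i (S.db j (S.pair B B)) =
      S.pair (S.cov i (S.bar j B)) B + S.pair (S.bar j B) (S.bar i B)
      + (S.pair (S.cov i B) (S.cov j B) + S.pair B (S.bar i (S.cov j B))) := by
  rw [db_pair, map_add, d_pair, d_pair]

/-- The Kähler condition as vanishing torsion. -/
theorem Th_symm (i k m : ι) : S.Th i k m = S.Th k i m := by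
  simp only [Th, Matrix.mul_apply, Matrix.map_apply]
  exact Finset.sum_congr rfl fun p _ => by rw [S.kahler]

theorem db_G_symm (i j k : ι) : S.db k (S.G i j) = S.db j (S.G i k) := by
  rw [← S.star_G j i, ← S.star_d, S.kahler, S.star_d, S.star_G]

/-- The curvature tensor of `G` with all indices lowered. -/
theorem curvature_lower (j k : ι) :
    (S.Th k).map (S.db j) * S.G =
      (S.G.map (S.d k)).map (S.db j) - S.Th k * S.G.map (S.db j) := by
  have h : S.Th k * S.G = S.G.map (S.d k) := by
    rw [Th, mul_assoc, mul_eq_one_comm.mp S.G_mul, mul_one]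
  rw [← h, matrix_map_derivation_mul, add_sub_cancel_right]

/-- By `curvature_lower` the conjugate derivative enters only through `db j` of entries of `G`,
where the conjugate Kähler condition exchanges `j` with the second index. -/
theorem curvature_symm (i j k q : ι) :
    ((S.Th k).map (S.db j) * S.G) i q = ((S.Th k).map (S.db q) * S.G) i j := by
  rw [curvature_lower, curvature_lower]
  simp only [Matrix.sub_apply, Matrix.map_apply, Matrix.mul_apply, ← S.d_db_comm]
  rw [S.db_G_symm]
  simp only [S.db_G_symm _ q j]

/-- On a Kähler manifold the mean curvature of the tangent bundle is the Ricci curvature. -/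
theorem mean_curvature_eq_zero (hR : ∀ j k, S.db j (S.Th k).trace = 0) (k m : ι) :
    ∑ i, ∑ j, S.Gi j i * S.db j (S.Th i k m) = 0 := by
  -- Exchanging `j` and `q` turns the contraction over form indices into an endomorphism trace,
  -- which is the Ricci curvature.
  have h1 : ∀ q, ∑ i, ∑ j, S.Gi j i * ((S.Th k).map (S.db j) * S.G) i q = 0 := by
    intro q
    have : ∑ i, ∑ j, ((S.Th k).map (S.db q) * S.G) i j * S.Gi j i
        = ((S.Th k).map (S.db q) * S.G * S.Gi).trace := by
      simp only [Matrix.trace, Matrix.diag, Matrix.mul_apply]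
    rw [mul_assoc, S.G_mul, mul_one, trace_map_derivation, hR] at this
    rw [← this]
    exact Finset.sum_congr rfl fun i _ => Finset.sum_congr rfl fun j _ => by
      rw [S.curvature_symm, mul_comm]
  have h2 : ∀ i j, S.db j (S.Th i k m) = ∑ q, ((S.Th k).map (S.db j) * S.G) i q * S.Gi q m := by
    intro i j
    rw [← Matrix.mul_apply, mul_assoc, S.G_mul, mul_one, Matrix.map_apply, S.Th_symm]
  simp only [h2, Finset.mul_sum]
  calc _ = ∑ q, (∑ i, ∑ j, S.Gi j i * ((S.Th k).map (S.db j) * S.G) i q) * S.Gi q m := by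
        simp only [Finset.sum_mul]
        rw [Finset.sum_comm' (t' := Finset.univ) (s' := fun _ => Finset.univ) (by simp)]
        rw [Finset.sum_comm]
        conv_rhs => rw [Finset.sum_comm]
        refine Finset.sum_congr rfl fun i _ => ?_
        conv_rhs => rw [Finset.sum_comm]
        exact Finset.sum_congr rfl fun j _ => Finset.sum_congr rfl fun q _ => by ring
    _ = 0 := by simp [h1]

end LocalMetrics
end Algebra
end KahlerHYM

namespace KahlerHYM

/-! ### Commuting covariant derivatives and the Bochner formula. -/

namespace LocalMetrics

variable {ι κ R : Type*} [Fintype ι] [DecidableEq ι] [Fintype κ] [DecidableEq κ]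
  [CommRing R] [Algebra ℂ R] [StarRing R] (S : LocalMetrics ι κ R)

theorem d_A (k i : ι) : (S.A i).map (S.d k) =
    (S.h.map (S.d i)).map (S.d k) * S.hi - S.A i * S.A k := by
  conv_lhs => rw [A]
  rw [matrix_map_derivation_mul, hi_map_d, mul_neg, ← mul_assoc, ← A, ← sub_eq_add_neg]

/-- The `(2,0)`-part of the curvature of the Chern connection vanishes. -/
theorem d_A_comm (k i : ι) :
    (S.A i).map (S.d k) = (S.A k).map (S.d i) + S.A k * S.A i - S.A i * S.A k := by
  have h : (S.h.map (S.d i)).map (S.d k) = (S.h.map (S.d k)).map (S.d i) := by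
    ext a b; simp [S.d_comm k i]
  rw [d_A, d_A, h]
  abel

theorem db_d_map (i j : ι) (M : Matrix κ κ R) :
    (M.map (S.d i)).map (S.db j) = (M.map (S.db j)).map (S.d i) := by
  ext a b; simp [S.d_db_comm]

omit [Fintype κ] [DecidableEq κ] [StarRing R] in
theorem map_add_derivation (D : Derivation ℂ R R) (M N : Matrix κ κ R) :
    (M + N).map D = M.map D + N.map D := by ext; simp

omit [Fintype κ] [DecidableEq κ] [StarRing R] in
theorem map_sub_derivation (D : Derivation ℂ R R) (M N : Matrix κ κ R) :
    (M - N).map D = M.map D - N.map D := by ext; simp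

omit [Fintype κ] [DecidableEq κ] [StarRing R] in
theorem map_smul_derivation (D : Derivation ℂ R R) (f : R) (M : Matrix κ κ R) :
    (f • M).map D = D f • M + f • M.map D := by
  ext; simp; ring

omit [Fintype κ] [DecidableEq κ] [StarRing R] in
theorem map_sum_derivation {α : Type*} (s : Finset α) (D : Derivation ℂ R R)
    (M : α → Matrix κ κ R) :
    (∑ a ∈ s, M a).map D = ∑ a ∈ s, (M a).map D := by
  ext; simp [Matrix.sum_apply]

/-- Since `d i` and `db j` commute, the commutator only contains conjugate derivatives of the
connection forms, that is, curvature. -/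
theorem bar_cov (i j : ι) (B : ι → Matrix κ κ R) (k : ι) :
    S.bar j (S.cov i B) k = S.cov i (S.bar j B) k - ∑ m, S.db j (S.Th i k m) • B m
      - (S.A i).map (S.db j) * B k + B k * (S.A i).map (S.db j) := by
  simp only [bar, cov, map_add_derivation, map_sub_derivation, map_sum_derivation,
    map_smul_derivation, matrix_map_derivation_mul, db_d_map, Finset.sum_add_distrib]
  abel

/-- The contraction of the second covariant derivatives in the order `∇ᵢ ∇_j̄` of the connection
form of a Hermitian-Yang-Mills metric on a Kähler manifold vanishes. -/
theorem sum_cov_bar_A {c : ℂ}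
    (hc : ∑ i, ∑ j, S.Gi j i • (S.A i).map (S.db j) = c • (1 : Matrix κ κ R)) (k : ι) :
    ∑ i, ∑ j, S.Gi j i • S.cov i (S.bar j S.A) k = 0 := by
  -- Differentiate the Hermitian-Yang-Mills equation along `z_k`; its right side is constant.
  have h1 := congrArg (fun M : Matrix κ κ R => M.map (S.d k)) hc
  have h0 : (c • (1 : Matrix κ κ R)).map (S.d k) = 0 := by
    ext a b
    by_cases hab : a = b <;> simp [hab]
  -- The mean curvature is scalar, so its commutator with `A k`, which `d_A_comm` produces, drops
  -- out.
  have hcomm : S.A k * (∑ i, ∑ j, S.Gi j i • (S.A i).map (S.db j)) =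
      (∑ i, ∑ j, S.Gi j i • (S.A i).map (S.db j)) * S.A k := by
    rw [hc]; simp
  simp only [Finset.mul_sum, Finset.sum_mul, Matrix.mul_smul, Matrix.smul_mul] at hcomm
  have h2 : ∀ i j, ((S.A i).map (S.db j)).map (S.d k) =
      ((S.A k).map (S.db j)).map (S.d i)
      + (S.A k).map (S.db j) * S.A i + S.A k * (S.A i).map (S.db j)
      - ((S.A i).map (S.db j) * S.A k + S.A i * (S.A k).map (S.db j)) := by
    intro i j
    rw [← db_d_map, d_A_comm, map_sub_derivation, map_add_derivation,
      matrix_map_derivation_mul, matrix_map_derivation_mul, db_d_map]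
    abel
  -- Vanishing torsion turns the derivative of `Gi` along `z_k` into the Christoffel term of `cov
  -- i`.
  have h3 : ∑ i, ∑ j, (∑ m, S.Gi j m * S.Th k m i) • (S.A i).map (S.db j) =
      ∑ i, ∑ j, S.Gi j i • ∑ m, S.Th i k m • (S.A m).map (S.db j) := by
    simp only [Finset.sum_smul, Finset.smul_sum, smul_smul]
    rw [Finset.sum_comm]
    conv_rhs => rw [Finset.sum_comm]
    refine Finset.sum_congr rfl fun j _ => ?_
    rw [Finset.sum_comm]
    exact Finset.sum_congr rfl fun i _ => Finset.sum_congr rfl fun m _ => by rw [S.Th_symm k]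
  simp only [map_sum_derivation, map_smul_derivation, h0, h2, d_Gi, neg_smul,
    smul_add, smul_sub, Finset.sum_add_distrib, Finset.sum_sub_distrib,
    Finset.sum_neg_distrib, h3, hcomm] at h1
  simp only [cov, bar, smul_add, smul_sub, Finset.sum_add_distrib, Finset.sum_sub_distrib]
  rw [← h1]
  abel

/-- The contraction of the second covariant derivatives in the order `∇_j̄ ∇ᵢ` of the connection
form of a Hermitian-Yang-Mills metric on a Ricci-flat Kähler manifold vanishes. -/
theorem sum_bar_cov_A (hR : ∀ j k, S.db j (S.Th k).trace = 0) {c : ℂ}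
    (hc : ∑ i, ∑ j, S.Gi j i • (S.A i).map (S.db j) = c • (1 : Matrix κ κ R)) (k : ι) :
    ∑ i, ∑ j, S.Gi j i • S.bar j (S.cov i S.A) k = 0 := by
  have hcomm : S.A k * (∑ i, ∑ j, S.Gi j i • (S.A i).map (S.db j)) =
      (∑ i, ∑ j, S.Gi j i • (S.A i).map (S.db j)) * S.A k := by
    rw [hc]; simp
  simp only [Finset.mul_sum, Finset.sum_mul, Matrix.mul_smul, Matrix.smul_mul] at hcomm
  -- Ricci-flatness enters through this term.
  have h1 : ∑ i, ∑ j, S.Gi j i • ∑ m, S.db j (S.Th i k m) • S.A m = 0 := by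
    calc _ = ∑ m, (∑ i, ∑ j, S.Gi j i * S.db j (S.Th i k m)) • S.A m := by
          simp only [Finset.sum_smul, Finset.smul_sum, smul_smul]
          conv_rhs => rw [Finset.sum_comm]
          refine Finset.sum_congr rfl fun i _ => ?_
          rw [Finset.sum_comm]
      _ = 0 := by simp [S.mean_curvature_eq_zero hR]
  simp only [bar_cov, smul_add, smul_sub, Finset.sum_add_distrib, Finset.sum_sub_distrib,
    S.sum_cov_bar_A hc, h1, hcomm]
  simp

theorem pair_sum_left {α : Type*} (s : Finset α) (f : α → R) (B : α → ι → Matrix κ κ R)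
    (C : ι → Matrix κ κ R) :
    S.pair (fun k => ∑ a ∈ s, f a • B a k) C = ∑ a ∈ s, f a * S.pair (B a) C := by
  simp only [pair, Finset.sum_mul, Finset.mul_sum, Matrix.smul_mul, Matrix.trace_sum,
    Matrix.trace_smul, smul_eq_mul]
  conv_rhs => rw [Finset.sum_comm]
  refine Finset.sum_congr rfl fun k _ => ?_
  rw [Finset.sum_comm]
  exact Finset.sum_congr rfl fun a _ => Finset.sum_congr rfl fun l _ => by ring

theorem sum_pair_left (B : ι → ι → ι → Matrix κ κ R) (C : ι → Matrix κ κ R)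
    (h : ∀ k, ∑ i, ∑ j, S.Gi j i • B i j k = 0) :
    ∑ i, ∑ j, S.Gi j i * S.pair (B i j) C = 0 := by
  have h1 := S.pair_sum_left (Finset.univ ×ˢ Finset.univ)
    (fun p : ι × ι => S.Gi p.2 p.1) (fun p => B p.1 p.2) C
  simp only [Finset.sum_product, h] at h1
  rw [← h1]
  simp [pair]

/-- The Bochner formula for the connection form of a Hermitian-Yang-Mills metric on a Ricci-flat
Kähler manifold. -/
theorem bochner (hR : ∀ j k, S.db j (S.Th k).trace = 0) {c : ℂ}
    (hc : ∑ i, ∑ j, S.Gi j i • (S.A i).map (S.db j) = c • (1 : Matrix κ κ R)) :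
    ∑ i, ∑ j, S.Gi j i * S.d i (S.db j (S.pair S.A S.A)) =
      (∑ i, ∑ j, S.Gi j i * S.pair (S.bar j S.A) (S.bar i S.A)) +
      ∑ i, ∑ j, S.Gi j i * S.pair (S.cov i S.A) (S.cov j S.A) := by
  have h1 := S.sum_pair_left _ S.A (S.sum_cov_bar_A hc)
  -- Conjugation moves the second-order factor into the linear slot and exchanges `i` and `j`.
  have h2 : ∑ i, ∑ j, S.Gi j i * S.pair S.A (S.bar i (S.cov j S.A)) = 0 := by
    have := congrArg star (S.sum_pair_left _ S.A (S.sum_bar_cov_A hR hc))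
    simp only [star_sum, star_mul', star_pair, star_Gi, star_zero] at this
    rw [Finset.sum_comm, this]
  simp only [d_db_pair, mul_add, Finset.sum_add_distrib, h1, h2, zero_add, add_zero]

end LocalMetrics
end KahlerHYM

/-! ### Positivity of the induced Hermitian forms. -/

namespace KahlerHYM

open scoped MatrixOrder in
theorem exists_eq_conjTranspose_mul_self {ι : Type*} [Fintype ι] {M : Matrix ι ι ℂ}
    (hM : M.PosSemidef) : ∃ N : Matrix ι ι ℂ, M = Nᴴ * N := by
  classical
  exact CStarAlgebra.nonneg_iff_eq_star_mul_self.mp hM.nonneg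

/-- Factoring `M = Nᴴ * N` turns the sum into values of `q` on the diagonal at the vectors `∑ k, N s
k • x k`. -/
theorem sum_sesq_nonneg {ι E : Type*} [Fintype ι] [DecidableEq ι] [AddCommGroup E] [Module ℂ E]
    (q : E →ₗ[ℂ] E →ₗ⋆[ℂ] ℂ) (hq : ∀ x, 0 ≤ q x x) {M : Matrix ι ι ℂ} (hM : M.PosSemidef)
    (x : ι → E) : 0 ≤ ∑ k, ∑ l, M l k * q (x k) (x l) := by
  obtain ⟨N, rfl⟩ := exists_eq_conjTranspose_mul_self hM
  have : ∑ k, ∑ l, (Nᴴ * N) l k * q (x k) (x l) =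
      ∑ s, q (∑ k, N s k • x k) (∑ k, N s k • x k) := by
    simp only [map_sum, LinearMap.sum_apply, map_smul, map_smulₛₗ, LinearMap.smul_apply,
      smul_eq_mul, Matrix.mul_apply, Matrix.conjTranspose_apply, Finset.sum_mul, Finset.mul_sum]
    conv_rhs => rw [Finset.sum_comm]
    conv_rhs => enter [2, l]; rw [Finset.sum_comm]
    conv_rhs => rw [Finset.sum_comm]
    refine Finset.sum_congr rfl fun k _ => Finset.sum_congr rfl fun l _ =>
      Finset.sum_congr rfl fun s _ => ?_
    simp only [starRingEnd_apply]
    ring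
  rw [this]
  exact Finset.sum_nonneg fun s _ => hq _

/-- The sesquilinear form `tr(B h C^* k)` on matrices. -/
def traceForm {κ : Type*} [Fintype κ] (h k : Matrix κ κ ℂ) :
    Matrix κ κ ℂ →ₗ[ℂ] Matrix κ κ ℂ →ₗ⋆[ℂ] ℂ :=
  LinearMap.mk₂'ₛₗ (RingHom.id ℂ) (starRingEnd ℂ) (fun B C => (B * h * Cᴴ * k).trace)
    (by intros; simp [add_mul]) (by intros; simp)
    (by intros; simp [mul_add, add_mul]) (by intros; simp)

/-- With `k = Nᴴ * N`, cyclicity gives the trace of the positive semidefinite matrix `(N B) h (N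
B)ᴴ`. -/
theorem traceForm_nonneg {κ : Type*} [Fintype κ] [DecidableEq κ] {h k : Matrix κ κ ℂ}
    (hh : h.PosSemidef) (hk : k.PosSemidef) (B : Matrix κ κ ℂ) : 0 ≤ traceForm h k B B := by
  obtain ⟨N, rfl⟩ := exists_eq_conjTranspose_mul_self hk
  have h1 := (hh.mul_mul_conjTranspose_same (N * B)).trace_nonneg
  rw [Matrix.conjTranspose_mul] at h1
  have : traceForm h (Nᴴ * N) B B = (N * B * h * (Bᴴ * Nᴴ)).trace := by
    change (B * h * Bᴴ * (Nᴴ * N)).trace = _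
    rw [← mul_assoc, Matrix.trace_mul_comm]
    simp only [mul_assoc]
  rwa [this]

/-- The sesquilinear form `∑ M l k tr(B k h (C l)^* k)` on families of matrices. -/
def pairForm {ι κ : Type*} [Fintype ι] [Fintype κ] (M : Matrix ι ι ℂ) (h k : Matrix κ κ ℂ) :
    (ι → Matrix κ κ ℂ) →ₗ[ℂ] (ι → Matrix κ κ ℂ) →ₗ⋆[ℂ] ℂ :=
  LinearMap.mk₂'ₛₗ (RingHom.id ℂ) (starRingEnd ℂ)
    (fun B C => ∑ a, ∑ b, M b a * traceForm h k (B a) (C b))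
    (by intros; simp [mul_add, Finset.sum_add_distrib])
    (by intros; simp [Finset.mul_sum, mul_left_comm])
    (by intros; simp [mul_add, Finset.sum_add_distrib])
    (by intros; simp [Finset.mul_sum, mul_left_comm])

theorem pairForm_nonneg {ι κ : Type*} [Fintype ι] [DecidableEq ι] [Fintype κ] [DecidableEq κ]
    {M : Matrix ι ι ℂ} {h k : Matrix κ κ ℂ} (hM : M.PosSemidef)
    (hh : h.PosSemidef) (hk : k.PosSemidef) (B : ι → Matrix κ κ ℂ) : 0 ≤ pairForm M h k B B :=
  sum_sesq_nonneg _ (traceForm_nonneg hh hk) hM B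

/-- The change-of-basis rule that makes the norm of a one-form independent of the tangent basis. -/
theorem pairForm_sum {ι κ : Type*} [Fintype ι] [Fintype κ] (M : Matrix ι ι ℂ)
    (h k : Matrix κ κ ℂ) (P : Matrix ι ι ℂ) (a : ι → Matrix κ κ ℂ) :
    pairForm M h k (fun i => ∑ m, P i m • a m) (fun i => ∑ m, P i m • a m) =
      pairForm (Pᴴ * M * P) h k a a := by
  change ∑ i, ∑ j, M j i * traceForm h k (∑ m, P i m • a m) (∑ m, P j m • a m) =
    ∑ m, ∑ s, (Pᴴ * M * P) s m * traceForm h k (a m) (a s)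
  simp only [map_sum, LinearMap.sum_apply, map_smul, map_smulₛₗ, LinearMap.smul_apply,
    smul_eq_mul, Matrix.mul_apply, Matrix.conjTranspose_apply, Finset.sum_mul, Finset.mul_sum]
  have h1 : ∀ F : ι → ι → ι → ι → ℂ, ∑ i, ∑ j, ∑ s, ∑ m, F i j s m =
      ∑ m, ∑ s, ∑ i, ∑ j, F i j s m := by
    intro F
    conv_lhs => enter [2, i, 2, j]; rw [Finset.sum_comm]
    conv_lhs => enter [2, i]; rw [Finset.sum_comm]
    rw [Finset.sum_comm]
    refine Finset.sum_congr rfl fun m _ => ?_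
    conv_lhs => enter [2, i]; rw [Finset.sum_comm]
    rw [Finset.sum_comm]
  rw [h1]
  refine Finset.sum_congr rfl fun m _ => Finset.sum_congr rfl fun s _ =>
    Finset.sum_congr rfl fun i _ => Finset.sum_congr rfl fun j _ => ?_
  simp only [starRingEnd_apply]
  ring

end KahlerHYM

/-! ### Smooth functions on an open set, with Wirtinger derivatives as derivations. -/

noncomputable section
namespace KahlerHYM

open TopologicalSpace (Opens)

variable {n : ℕ} {U : Opens (Cn n)}

/-- Extension by zero of a function on an open set. -/
def extendZero (f : U → ℂ) : Cn n → ℂ := Function.extend Subtype.val f 0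

theorem extendZero_apply (f : U → ℂ) {w : Cn n} (hw : w ∈ U) : extendZero f w = f ⟨w, hw⟩ :=
  Subtype.val_injective.extend_apply f 0 ⟨w, hw⟩

theorem contDiffOn_extendZero {f : U → ℂ} {F : Cn n → ℂ} (hF : ContDiffOn ℝ ∞ F U)
    (h : ∀ w : U, f w = F w) : ContDiffOn ℝ ∞ (extendZero f) U :=
  hF.congr fun w hw => by rw [extendZero_apply f hw, h]

variable (U) in
/-- The algebra of complex functions on `U` that are smooth in the real sense. -/
def smoothFun : StarSubalgebra ℂ (U → ℂ) where
  -- `fderiv` needs a function on the whole space; as `U` is open, the values outside do not affect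
  -- derivatives in `U`. Elements are functions on `U` itself, so equality is equality on `U`.
  carrier := {f | ContDiffOn ℝ ∞ (extendZero f) U}
  mul_mem' {f g} hf hg := contDiffOn_extendZero (hf.mul hg) fun w => by
    simp [extendZero_apply _ w.2]
  add_mem' {f g} hf hg := contDiffOn_extendZero (hf.add hg) fun w => by
    simp [extendZero_apply _ w.2]
  algebraMap_mem' c := contDiffOn_extendZero (contDiffOn_const (c := c)) fun w => rfl
  star_mem' {f} hf := contDiffOn_extendZero
    (F := fun w => Complex.conjCLE (extendZero f w))
    (Complex.conjCLE.contDiff.comp_contDiffOn hf) fun w => by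
      simp [extendZero_apply _ w.2]

/-- The element of `smoothFun U` given by a function that is smooth on `U`. -/
def toSmooth (F : Cn n → ℂ) (hF : ContDiffOn ℝ ∞ F U) : smoothFun U :=
  ⟨fun w => F w, contDiffOn_extendZero hF fun _ => rfl⟩

theorem contDiffOn_fderiv_apply {f : Cn n → ℂ} (hf : ContDiffOn ℝ ∞ f U) (v : Cn n) :
    ContDiffOn ℝ ∞ (fun z => fderiv ℝ f z v) U :=
  (hf.fderiv_of_isOpen U.2 (by simp)).clm_apply contDiffOn_const

theorem fderiv_congr_of_eqOn {f g : Cn n → ℂ} (h : Set.EqOn f g U) {z : Cn n} (hz : z ∈ U) :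
    fderiv ℝ f z = fderiv ℝ g z :=
  (Filter.eventuallyEq_of_mem (U.2.mem_nhds hz) h).fderiv_eq

theorem dz_congr_of_eqOn {f g : Cn n → ℂ} (h : Set.EqOn f g U) (i : Fin n) :
    Set.EqOn (dz i f) (dz i g) U := fun z hz => by
  simp only [dz, fderiv_congr_of_eqOn h hz]

theorem dzbar_congr_of_eqOn {f g : Cn n → ℂ} (h : Set.EqOn f g U) (i : Fin n) :
    Set.EqOn (dzbar i f) (dzbar i g) U := fun z hz => by
  simp only [dzbar, fderiv_congr_of_eqOn h hz]

theorem differentiableAt_of_contDiffOn {f : Cn n → ℂ} (hf : ContDiffOn ℝ ∞ f U) {z : Cn n}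
    (hz : z ∈ U) : DifferentiableAt ℝ f z :=
  (hf.contDiffAt (U.2.mem_nhds hz)).differentiableAt (by simp)

/-- The `ℂ`-linear combination `a ∂ᵥ + b ∂_w` of two directional derivatives as a derivation of
`smoothFun U`. -/
def dirDeriv (a b : ℂ) (v w : Cn n) : Derivation ℂ (smoothFun U) (smoothFun U) :=
  Derivation.mk'
    { toFun := fun f => toSmooth
        (fun z => a * fderiv ℝ (extendZero f.1) z v + b * fderiv ℝ (extendZero f.1) z w)
        ((contDiffOn_const.mul (contDiffOn_fderiv_apply f.2 _)).add
          (contDiffOn_const.mul (contDiffOn_fderiv_apply f.2 _)))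
      map_add' := fun f g => by
        ext z
        have h : fderiv ℝ (extendZero (f + g).1) z =
            fderiv ℝ (extendZero f.1) z + fderiv ℝ (extendZero g.1) z := by
          rw [← fderiv_add (differentiableAt_of_contDiffOn f.2 z.2)
            (differentiableAt_of_contDiffOn g.2 z.2)]
          exact fderiv_congr_of_eqOn (fun w hw => by simp [extendZero_apply _ hw]) z.2
        change a * fderiv ℝ (extendZero (f + g).1) z v + b * fderiv ℝ (extendZero (f + g).1) z w =
          (a * fderiv ℝ (extendZero f.1) z v + b * fderiv ℝ (extendZero f.1) z w) +
          (a * fderiv ℝ (extendZero g.1) z v + b * fderiv ℝ (extendZero g.1) z w)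
        rw [h]
        simp only [add_apply]
        ring
      map_smul' := fun c f => by
        ext z
        have h : fderiv ℝ (extendZero (c • f).1) z = c • fderiv ℝ (extendZero f.1) z := by
          rw [← fderiv_const_smul (differentiableAt_of_contDiffOn f.2 z.2)]
          exact fderiv_congr_of_eqOn (fun w hw => by simp [extendZero_apply _ hw]) z.2
        change a * fderiv ℝ (extendZero (c • f).1) z v + b * fderiv ℝ (extendZero (c • f).1) z w =
          c * (a * fderiv ℝ (extendZero f.1) z v + b * fderiv ℝ (extendZero f.1) z w)
        rw [h]
        simp only [smul_apply, smul_eq_mul]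
        ring }
    fun f g => by
      ext z
      have h : fderiv ℝ (extendZero (f * g).1) z =
          f.1 z • fderiv ℝ (extendZero g.1) z + g.1 z • fderiv ℝ (extendZero f.1) z := by
        rw [← extendZero_apply f.1 z.2, ← extendZero_apply g.1 z.2,
          ← fderiv_mul (differentiableAt_of_contDiffOn f.2 z.2)
          (differentiableAt_of_contDiffOn g.2 z.2)]
        exact fderiv_congr_of_eqOn (fun w hw => by simp [extendZero_apply _ hw]) z.2
      change a * fderiv ℝ (extendZero (f * g).1) z v + b * fderiv ℝ (extendZero (f * g).1) z w =
          f.1 z * (a * fderiv ℝ (extendZero g.1) z v + b * fderiv ℝ (extendZero g.1) z w) +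
          g.1 z * (a * fderiv ℝ (extendZero f.1) z v + b * fderiv ℝ (extendZero f.1) z w)
      rw [h]
      simp only [add_apply, smul_apply, smul_eq_mul]
      ring

theorem dirDeriv_apply (a b : ℂ) (v w : Cn n) (f : smoothFun U) (z : U) :
    (dirDeriv a b v w f).1 z =
      a * fderiv ℝ (extendZero f.1) z v + b * fderiv ℝ (extendZero f.1) z w := rfl

theorem fderiv_fderiv_comm {f : Cn n → ℂ} (hf : ContDiffOn ℝ ∞ f U) {z : Cn n} (hz : z ∈ U)
    (v w : Cn n) :
    fderiv ℝ (fun u => fderiv ℝ f u v) z w = fderiv ℝ (fun u => fderiv ℝ f u w) z v := by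
  have h1 := hf.contDiffAt (U.2.mem_nhds hz)
  have h2 : DifferentiableAt ℝ (fderiv ℝ f) z :=
    ((hf.fderiv_of_isOpen U.2 (m := ∞) (by simp)).contDiffAt
      (U.2.mem_nhds hz)).differentiableAt (by simp)
  have h3 : ∀ v w, fderiv ℝ (fun u => fderiv ℝ f u v) z w = fderiv ℝ (fderiv ℝ f) z w v := by
    intro v w
    rw [fderiv_clm_apply h2 (differentiableAt_const v)]
    simp
  rw [h3, h3]
  exact (h1.isSymmSndFDerivAt (by
    rw [minSmoothness_of_isRCLikeNormedField]; exact WithTop.coe_le_coe.mpr le_top)) w v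

theorem fderiv_dirDeriv (a b : ℂ) (v w : Cn n) (f : smoothFun U) (z : U) (u : Cn n) :
    fderiv ℝ (extendZero (dirDeriv a b v w f).1) z u =
      a * fderiv ℝ (fun y => fderiv ℝ (extendZero f.1) y v) z u +
      b * fderiv ℝ (fun y => fderiv ℝ (extendZero f.1) y w) z u := by
  have hd : ∀ v, DifferentiableAt ℝ (fun y => fderiv ℝ (extendZero f.1) y v) z := fun v =>
    differentiableAt_of_contDiffOn (contDiffOn_fderiv_apply f.2 v) z.2
  rw [fderiv_congr_of_eqOn (g := fun y => a * fderiv ℝ (extendZero f.1) y v +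
      b * fderiv ℝ (extendZero f.1) y w) (fun y hy => extendZero_apply _ hy) z.2,
    fderiv_fun_add ((hd v).const_mul a) ((hd w).const_mul b), fderiv_const_mul (hd v),
    fderiv_const_mul (hd w)]
  simp

theorem dirDeriv_comm (a b a' b' : ℂ) (v w v' w' : Cn n) (f : smoothFun U) :
    dirDeriv a b v w (dirDeriv a' b' v' w' f) = dirDeriv a' b' v' w' (dirDeriv a b v w f) := by
  ext z
  simp only [dirDeriv_apply, fderiv_dirDeriv]
  rw [fderiv_fderiv_comm f.2 z.2 v' v, fderiv_fderiv_comm f.2 z.2 v' w,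
    fderiv_fderiv_comm f.2 z.2 w' v, fderiv_fderiv_comm f.2 z.2 w' w]
  ring

/-- `∂/∂zᵢ` as a derivation of the algebra of smooth functions. -/
def dzDer (i : Fin n) : Derivation ℂ (smoothFun U) (smoothFun U) :=
  dirDeriv 2⁻¹ (-(Complex.I / 2)) (EuclideanSpace.single i 1) (EuclideanSpace.single i Complex.I)

/-- `∂/∂z̄ᵢ` as a derivation of the algebra of smooth functions. -/
def dzbarDer (i : Fin n) : Derivation ℂ (smoothFun U) (smoothFun U) :=
  dirDeriv 2⁻¹ (Complex.I / 2) (EuclideanSpace.single i 1) (EuclideanSpace.single i Complex.I)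

theorem dzDer_apply (i : Fin n) {f : smoothFun U} {F : Cn n → ℂ} (h : ∀ w : U, f.1 w = F w)
    (z : U) : (dzDer i f).1 z = dz i F z := by
  rw [← dz_congr_of_eqOn (f := extendZero f.1) (U := U)
    (fun w hw => by rw [extendZero_apply _ hw, h]) i z.2, dzDer, dirDeriv_apply, dz]
  ring

theorem dzbarDer_apply (i : Fin n) {f : smoothFun U} {F : Cn n → ℂ} (h : ∀ w : U, f.1 w = F w)
    (z : U) : (dzbarDer i f).1 z = dzbar i F z := by
  rw [← dzbar_congr_of_eqOn (f := extendZero f.1) (U := U)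
    (fun w hw => by rw [extendZero_apply _ hw, h]) i z.2, dzbarDer, dirDeriv_apply, dzbar]
  ring

theorem star_dzDer (i : Fin n) (f : smoothFun U) : star (dzDer i f) = dzbarDer i (star f) := by
  ext z
  have h1 : ∀ v, fderiv ℝ (extendZero (star f).1) z v = star (fderiv ℝ (extendZero f.1) z v) := by
    intro v
    rw [fderiv_congr_of_eqOn (g := fun w => Complex.conjCLE (extendZero f.1 w))
      (fun w hw => by simp [extendZero_apply _ hw]) z.2]
    have := (Complex.conjCLE.toContinuousLinearMap.hasFDerivAt.comp (z : Cn n)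
      (differentiableAt_of_contDiffOn f.2 z.2).hasFDerivAt).fderiv
    exact congrArg (fun L => L v) this
  change star ((dzDer i f).1 z) = _
  rw [dzDer, dzbarDer, dirDeriv_apply, dirDeriv_apply, h1, h1]
  simp [Complex.conj_I]
  ring

end KahlerHYM
end

/-! ### Chart coordinates against the standard basis of the tangent space. -/

noncomputable section
namespace KahlerHYM

/-- The expression is the complex-linear part of the real-linear map `D`. -/
theorem wirtinger_smul {n : ℕ} (D : Cn n →L[ℝ] ℂ) (c : ℂ) (v : Cn n) :
    (D (c • v) - Complex.I * D (Complex.I • c • v)) / 2 =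
      c * ((D v - Complex.I * D (Complex.I • v)) / 2) := by
  have h1 : c • v = c.re • v + c.im • (Complex.I • v) := by
    conv_lhs => rw [← Complex.re_add_im c, add_smul, mul_smul]
    simp only [Complex.coe_smul]
  have h2 : Complex.I • c • v = c.re • (Complex.I • v) - c.im • v := by
    rw [h1, smul_add, smul_comm, smul_comm Complex.I c.im, smul_smul, Complex.I_mul_I]
    simp [sub_eq_add_neg]
  rw [h2, h1, map_add, map_sub]
  simp only [D.map_smul, Complex.real_smul]
  conv_rhs => rw [← Complex.re_add_im c]
  linear_combination ((c.im : ℂ) * D (Complex.I • v) / 2) * Complex.I_sq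

theorem wirtinger_sum {n : ℕ} (D : Cn n →L[ℝ] ℂ) {ι : Type*} (s : Finset ι) (c : ι → ℂ)
    (v : ι → Cn n) :
    (D (∑ k ∈ s, c k • v k) - Complex.I * D (Complex.I • ∑ k ∈ s, c k • v k)) / 2 =
      ∑ k ∈ s, c k * ((D (v k) - Complex.I * D (Complex.I • v k)) / 2) := by
  simp only [← wirtinger_smul, Finset.smul_sum, map_sum, Finset.mul_sum,
    ← Finset.sum_sub_distrib, Finset.sum_div]

section Charts

variable {n r : ℕ} {V : Type*} [TopologicalSpace V] [ChartedSpace (Cn n) V]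

theorem mdifferentiableAt_real {z : Cn n} {φ : Cn n → V}
    (h : MDifferentiableAt 𝓘(ℂ, Cn n) 𝓘(ℂ, Cn n) φ z) :
    MDifferentiableAt 𝓘(ℝ, Cn n) 𝓘(ℝ, Cn n) φ z :=
  (mdifferentiableAt_iff _ _).mpr
    ⟨h.continuousAt, (((mdifferentiableAt_iff _ _).mp h).2).restrictScalars ℝ⟩

theorem mfderiv_real_apply {z : Cn n} {φ : Cn n → V}
    (h : MDifferentiableAt 𝓘(ℂ, Cn n) 𝓘(ℂ, Cn n) φ z) (v : Cn n) :
    (mfderiv 𝓘(ℝ, Cn n) 𝓘(ℝ, Cn n) φ z v : Cn n) = (mfderiv 𝓘(ℂ, Cn n) 𝓘(ℂ, Cn n) φ z v : Cn n) := by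
  have h2 := ((mdifferentiableAt_iff _ _).mp h).2
  simp only [mfderiv, mdifferentiableAt_real h, h]
  simp only [modelWithCornersSelf_coe, Set.range_id, differentiableWithinAt_univ,
    fderivWithin_univ] at h2 ⊢
  exact congrArg (fun L => L v) (h2.fderiv_restrictScalars ℝ)

theorem contMDiffAt_real {z : Cn n} {φ : Cn n → V}
    (h : ContMDiffAt 𝓘(ℂ, Cn n) 𝓘(ℂ, Cn n) ω φ z) :
    ContMDiffAt 𝓘(ℝ, Cn n) 𝓘(ℝ, Cn n) ∞ φ z := by
  rw [contMDiffAt_iff] at h ⊢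
  exact ⟨h.1, ((h.2.restrict_scalars ℝ).of_le (by simp))⟩

variable [IsManifold 𝓘(ℂ, Cn n) ω V] {e : OpenPartialHomeomorph V (Cn n)}
  (he : e ∈ IsManifold.maximalAtlas 𝓘(ℂ, Cn n) ω V)

include he

omit [IsManifold 𝓘(ℂ, Cn n) ω V] in
theorem contMDiffAt_symm {z : Cn n} (hz : z ∈ e.target) :
    ContMDiffAt 𝓘(ℂ, Cn n) 𝓘(ℂ, Cn n) ω e.symm z :=
  (contMDiffOn_symm_of_mem_maximalAtlas he).contMDiffAt (e.open_target.mem_nhds hz)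

omit [IsManifold 𝓘(ℂ, Cn n) ω V] in
theorem mdifferentiableAt_symm {z : Cn n} (hz : z ∈ e.target) :
    MDifferentiableAt 𝓘(ℂ, Cn n) 𝓘(ℂ, Cn n) e.symm z :=
  (contMDiffAt_symm he hz).mdifferentiableAt (by simp)

theorem mfderiv_symm_leftInverse {z : Cn n} (hz : z ∈ e.target) (v : Cn n) :
    mfderiv 𝓘(ℂ, Cn n) 𝓘(ℂ, Cn n) e (e.symm z)
      (mfderiv 𝓘(ℂ, Cn n) 𝓘(ℂ, Cn n) e.symm z v) = v := by
  have h1 : MDifferentiableAt 𝓘(ℂ, Cn n) 𝓘(ℂ, Cn n) e (e.symm z) :=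
    ((contMDiffOn_of_mem_maximalAtlas he).contMDiffAt
      (e.open_source.mem_nhds (e.map_target hz))).mdifferentiableAt (by simp)
  have h2 := mfderiv_comp z h1 (mdifferentiableAt_symm he hz)
  have h3 : e ∘ e.symm =ᶠ[nhds z] id :=
    Filter.eventuallyEq_of_mem (e.open_target.mem_nhds hz) fun w hw => e.right_inv hw
  rw [h3.mfderiv_eq, mfderiv_id] at h2
  exact (congrArg (fun L => L v) h2).symm

namespace BundleMetric

variable (H : BundleMetric n r V)

omit [IsManifold 𝓘(ℂ, Cn n) ω V] in
theorem contDiffOn_mat_symm (α β : Fin r) :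
    ContDiffOn ℝ ∞ (fun z => H.mat (e.symm z) α β) e.target := fun z hz => by
  have := (H.smooth α β).contMDiffAt.comp z (contMDiffAt_real (contMDiffAt_symm he hz))
  exact (contMDiffAt_iff_contDiffAt.mp this).contDiffWithinAt

-- Chain rule through `e.symm`: its differential is complex linear, so multiplication by `Complex.I`
-- passes through it and `∂` becomes the coordinate `dz i`.
omit [IsManifold 𝓘(ℂ, Cn n) ω V] in
theorem connForm_coordVec {z : Cn n} (hz : z ∈ e.target) (i : Fin n) :
    H.connForm (e.symm z) (coordVec e z i) =
      Matrix.of (fun α β => dz i (fun w => H.mat (e.symm w) α β) z) * (H.mat (e.symm z))⁻¹ := by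
  rw [connForm]
  congr 1
  ext α β
  have h1 := mdifferentiableAt_symm he hz
  have h2 := mfderiv_comp z ((H.smooth α β).contMDiffAt.mdifferentiableAt (by simp))
    (mdifferentiableAt_real h1)
  rw [mfderiv_eq_fderiv] at h2
  have h3 : ∀ v : Cn n, fderiv ℝ (fun w => H.mat (e.symm w) α β) z v =
      mfderiv 𝓘(ℝ, Cn n) 𝓘(ℝ, ℂ) (fun y => H.mat y α β) (e.symm z)
        (mfderiv 𝓘(ℂ, Cn n) 𝓘(ℂ, Cn n) e.symm z v : Cn n) := by
    intro v
    rw [← mfderiv_real_apply h1]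
    exact congrArg (fun L => L v) h2
  have h4 : (EuclideanSpace.single i Complex.I : Cn n) =
      Complex.I • (EuclideanSpace.single i 1 : Cn n) := by
    ext k; simp
  simp only [del, Matrix.of_apply, dz, h3, h4, coordVec]
  let T : Cn n →L[ℂ] Cn n := mfderiv 𝓘(ℂ, Cn n) 𝓘(ℂ, Cn n) e.symm z
  let D : Cn n → ℂ := fun v => mfderiv 𝓘(ℝ, Cn n) 𝓘(ℝ, ℂ) (fun y => H.mat y α β) (e.symm z) v
  let s : Cn n := EuclideanSpace.single i 1
  change (D (T s) - Complex.I * D (Complex.I • T s)) / 2 =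
    (D (T s) - Complex.I * D (T (Complex.I • s))) / 2
  rw [T.map_smul]

omit he [IsManifold 𝓘(ℂ, Cn n) ω V] in
theorem connForm_sum (x : V) {ι : Type*} (s : Finset ι) (c : ι → ℂ) (v : ι → Cn n) :
    H.connForm x (∑ k ∈ s, c k • v k : Cn n) = ∑ k ∈ s, c k • H.connForm x (v k : Cn n) := by
  have h : H.del x (∑ k ∈ s, c k • v k : Cn n) = ∑ k ∈ s, c k • H.del x (v k : Cn n) := by
    ext α β
    rw [Matrix.sum_apply]
    exact wirtinger_sum (mfderiv 𝓘(ℝ, Cn n) 𝓘(ℝ, ℂ) (fun y => H.mat y α β) x) s c v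
  simp only [connForm, h, Finset.sum_mul, Matrix.smul_mul]

end BundleMetric

/-- The coefficients of the coordinate vectors in the standard basis of the tangent space. -/
def coordMat {V : Type*} [TopologicalSpace V] [ChartedSpace (Cn n) V]
    (e : OpenPartialHomeomorph V (Cn n)) (z : Cn n) : Matrix (Fin n) (Fin n) ℂ :=
  Matrix.of fun i => WithLp.ofLp (p := 2) (coordVec e z i : Cn n)

omit he [IsManifold 𝓘(ℂ, Cn n) ω V] in
theorem coordVec_eq_sum (z : Cn n) (i : Fin n) :
    (coordVec e z i : Cn n) = ∑ k, coordMat e z i k • (EuclideanSpace.single k 1 : Cn n) := by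
  refine PiLp.ext fun m => ?_
  simp [coordMat, Pi.single_apply]

/-- The differential of `e` supplies the inverse matrix. -/
theorem isUnit_coordMat {z : Cn n} (hz : z ∈ e.target) : IsUnit (coordMat e z) := by
  let T : Cn n →L[ℂ] Cn n := mfderiv 𝓘(ℂ, Cn n) 𝓘(ℂ, Cn n) e (e.symm z)
  let Q : Matrix (Fin n) (Fin n) ℂ := Matrix.of fun i k => T (EuclideanSpace.single i 1) k
  refine (isUnit_iff_exists_inv).mpr ⟨Q, ?_⟩
  ext i k
  have h : T (coordVec e z i : Cn n) = EuclideanSpace.single i 1 :=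
    mfderiv_symm_leftInverse he hz _
  rw [coordVec_eq_sum, map_sum] at h
  have h2 := congrArg (fun v : Cn n => v k) h
  simp only [map_smul] at h2
  simpa [Matrix.mul_apply, Q, Matrix.one_apply, Pi.single_apply, eq_comm] using h2

namespace HermitianMetric

variable (g : HermitianMetric n V)

omit he [IsManifold 𝓘(ℂ, Cn n) ω V]

/-- The Gram matrix of the metric in the standard basis of a tangent space. -/
def gram (x : V) : Matrix (Fin n) (Fin n) ℂ :=
  Matrix.of fun k l => g.form x (EuclideanSpace.single k 1 : Cn n) (EuclideanSpace.single l 1 : Cn n)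

theorem form_sum (x : V) (a b : Fin n → ℂ) (v : Fin n → Cn n) :
    g.form x (∑ k, a k • v k : Cn n) (∑ l, b l • v l : Cn n) =
      ∑ k, ∑ l, a k * g.form x (v k : Cn n) (v l : Cn n) * star (b l) := by
  let B : Cn n →ₗ[ℂ] Cn n →ₗ⋆[ℂ] ℂ := g.form x
  change B _ _ = ∑ k, ∑ l, a k * B (v k) (v l) * star (b l)
  simp only [map_sum, LinearMap.sum_apply, map_smul, map_smulₛₗ, LinearMap.smul_apply, smul_eq_mul]
  rw [Finset.sum_comm]
  simp only [Finset.mul_sum]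
  refine Finset.sum_congr rfl fun k _ => Finset.sum_congr rfl fun l _ => ?_
  simp only [starRingEnd_apply]
  ring

theorem gram_posDef (x : V) : (g.gram x).PosDef := by
  refine Matrix.PosDef.of_dotProduct_mulVec_pos ?_ fun a ha => ?_
  · ext i j
    exact g.conj_symm x _ _
  · have h := g.form_sum x (star a) (star a) fun k => (EuclideanSpace.single k 1 : Cn n)
    set v : Cn n := ∑ k, (star a) k • (EuclideanSpace.single k 1 : Cn n) with hv
    have hv0 : v ≠ 0 := by
      intro h0
      apply ha
      ext m
      have := congrArg (fun w : Cn n => w m) h0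
      simpa [hv, Pi.single_apply] using this
    have h1 : star a ⬝ᵥ (g.gram x).mulVec a = g.form x v v := by
      rw [h]
      simp only [dotProduct, Matrix.mulVec, Finset.mul_sum, gram, Matrix.of_apply]
      refine Finset.sum_congr rfl fun k _ => Finset.sum_congr rfl fun l _ => ?_
      simp [mul_assoc]
    rw [h1, Complex.lt_def]
    refine ⟨g.pos x v hv0, ?_⟩
    have := Complex.conj_eq_iff_im.mp (g.conj_symm x v v)
    simp [this]

theorem coeff_eq (z : Cn n) :
    g.coeff e z = coordMat e z * g.gram (e.symm z) * (coordMat e z)ᴴ := by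
  ext i j
  have h := g.form_sum (e.symm z) (coordMat e z i) (coordMat e z j)
    fun k => (EuclideanSpace.single k 1 : Cn n)
  rw [← coordVec_eq_sum, ← coordVec_eq_sum] at h
  refine h.trans ?_
  simp only [Matrix.mul_apply, Finset.sum_mul, Matrix.conjTranspose_apply]
  rw [Finset.sum_comm]
  rfl

end HermitianMetric

theorem HermitianMetric.coeff_posDef (g : HermitianMetric n V) {z : Cn n} (hz : z ∈ e.target) :
    (g.coeff e z).PosDef := by
  rw [g.coeff_eq]
  exact (Matrix.IsUnit.posDef_star_right_conjugate_iff (isUnit_coordMat he hz)).mpr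
    (g.gram_posDef _)

/-- The squared norm of the connection form, in terms of the coordinate vectors of a chart. -/
theorem BundleMetric.normSqConnForm_symm (g : HermitianMetric n V) (H : BundleMetric n r V)
    {z : Cn n} (hz : z ∈ e.target) :
    H.normSqConnForm g (e.symm z) = (pairForm (g.coeff e z)⁻¹ (H.mat (e.symm z))
      (H.mat (e.symm z))⁻¹ (fun k => H.connForm (e.symm z) (coordVec e z k))
      (fun k => H.connForm (e.symm z) (coordVec e z k))).re := by
  set x := e.symm z
  set P := coordMat e z
  set h := H.mat x
  let a : Fin n → Matrix (Fin r) (Fin r) ℂ :=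
    fun k => H.connForm x (EuclideanSpace.single k 1 : Cn n)
  have hlin : (fun k => H.connForm x (coordVec e z k)) = fun k => ∑ m, P k m • a m := by
    funext k
    exact (congrArg (H.connForm x) (coordVec_eq_sum z k)).trans (H.connForm_sum x _ _ _)
  -- The inverse metric transforms contragrediently, cancelling the change of basis in the one-form.
  have hG : Pᴴ * (g.coeff e z)⁻¹ * P = (g.gram x)⁻¹ := by
    have hP : IsUnit P.det := (Matrix.isUnit_iff_isUnit_det _).mp (isUnit_coordMat he hz)
    have hP' : IsUnit Pᴴ.det := by rw [Matrix.det_conjTranspose]; exact hP.star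
    rw [g.coeff_eq, Matrix.mul_inv_rev, Matrix.mul_inv_rev]
    simp only [mul_assoc]
    rw [Matrix.nonsing_inv_mul _ hP, mul_one, ← mul_assoc, Matrix.mul_nonsing_inv _ hP', one_mul]
  rw [hlin, pairForm_sum, hG]
  change (∑ k, ∑ l, (g.gram x)⁻¹ l k * H.inner x (a k) (a l)).re = _
  refine congrArg Complex.re ?_
  refine Finset.sum_congr rfl fun k _ => Finset.sum_congr rfl fun l _ => ?_
  congr 1
  change (a k * (h * (a l)ᴴ * h⁻¹)).trace = (a k * h * (a l)ᴴ * h⁻¹).trace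
  simp only [mul_assoc]

end Charts
end KahlerHYM
end

/-! ### Evaluating the Bochner formula in a chart. -/

noncomputable section
namespace KahlerHYM

section Final

variable {n r : ℕ} {V : Type*} [TopologicalSpace V] [ChartedSpace (Cn n) V]
  [IsManifold 𝓘(ℂ, Cn n) ω V] {e : OpenPartialHomeomorph V (Cn n)}

/-- The target of a chart as an open set. -/
def targetOpens (e : OpenPartialHomeomorph V (Cn n)) : TopologicalSpace.Opens (Cn n) :=
  ⟨e.target, e.open_target⟩

/-- A matrix of functions that are smooth on `U`, as a matrix over the algebra `smoothFun U`. -/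
def smoothMat {ι : Type*} {U : TopologicalSpace.Opens (Cn n)} (F : Cn n → Matrix ι ι ℂ)
    (hF : ∀ i j, ContDiffOn ℝ ∞ (fun z => F z i j) U) : Matrix ι ι (smoothFun U) :=
  Matrix.of fun i j => toSmooth (fun z => F z i j) (hF i j)

/-- Evaluation of smooth functions at a point. -/
def evalHom {U : TopologicalSpace.Opens (Cn n)} (z : U) : smoothFun U →+* ℂ where
  toFun f := f.1 z
  map_one' := rfl
  map_zero' := rfl
  map_add' _ _ := rfl
  map_mul' _ _ := rfl

theorem smoothFun_ext {U : TopologicalSpace.Opens (Cn n)} {f g : smoothFun U}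
    (h : ∀ z, evalHom z f = evalHom z g) : f = g := Subtype.ext (funext h)

theorem map_eval_injective {ι : Type*} {U : TopologicalSpace.Opens (Cn n)}
    {M N : Matrix ι ι (smoothFun U)} (h : ∀ z, M.map (evalHom z) = N.map (evalHom z)) : M = N := by
  ext1 i j
  exact smoothFun_ext fun z => congrFun (congrFun (h z) i) j

/-- The determinant vanishes nowhere on `U`, so its reciprocal is smooth and the determinant is a
unit of the algebra. -/
theorem smoothMat_mul_inv {ι : Type*} [Fintype ι] [DecidableEq ι]
    {U : TopologicalSpace.Opens (Cn n)} (F : Cn n → Matrix ι ι ℂ)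
    (hF : ∀ i j, ContDiffOn ℝ ∞ (fun z => F z i j) U) (h : ∀ z ∈ U, IsUnit (F z)) :
    smoothMat F hF * (smoothMat F hF)⁻¹ = 1 := by
  apply Matrix.mul_nonsing_inv
  have hev : ∀ z : U, evalHom z (smoothMat F hF).det = (F z).det := fun z => by
    rw [RingHom.map_det]; rfl
  have hdet : ContDiffOn ℝ ∞ (fun z => (F z).det) U := by
    simp only [Matrix.det_apply]
    exact ContDiffOn.sum fun σ _ => (contDiffOn_prod fun i _ => hF _ _).const_smul _
  have hne : ∀ z ∈ U, (F z).det ≠ 0 := fun z hz =>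
    ((Matrix.isUnit_iff_isUnit_det _).mp (h z hz)).ne_zero
  refine isUnit_iff_exists_inv.mpr ⟨toSmooth (fun z => ((F z).det)⁻¹) (hdet.inv hne), ?_⟩
  refine smoothFun_ext fun z => ?_
  rw [map_mul, hev, map_one]
  exact mul_inv_cancel₀ (hne z z.2)

theorem map_eval_inv {ι : Type*} [Fintype ι] [DecidableEq ι]
    {U : TopologicalSpace.Opens (Cn n)} {M N : Matrix ι ι (smoothFun U)} (h : M * N = 1) (z : U) :
    N.map (evalHom z) = (M.map (evalHom z))⁻¹ := by
  refine (Matrix.inv_eq_right_inv ?_).symm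
  rw [← Matrix.map_mul, h, Matrix.map_one _ (map_zero _) (map_one _)]

theorem conjTranspose_eq_self {ι : Type*} {U : TopologicalSpace.Opens (Cn n)}
    {M : Matrix ι ι (smoothFun U)} (h : ∀ z, (M.map (evalHom z)).IsHermitian) : Mᴴ = M :=
  map_eval_injective fun z => (h z)

variable (he : e ∈ IsManifold.maximalAtlas 𝓘(ℂ, Cn n) ω V) (g : HermitianMetric n V)
  (hK : g.IsKahler) (H : BundleMetric n r V)

/-- The coefficients of a Kähler metric and a bundle metric in a chart. -/
def chartMetrics : LocalMetrics (Fin n) (Fin r) (smoothFun (targetOpens e)) where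
  d := dzDer
  db := dzbarDer
  star_d := star_dzDer
  d_comm _ _ _ := dirDeriv_comm _ _ _ _ _ _ _ _ _
  d_db_comm _ _ _ := dirDeriv_comm _ _ _ _ _ _ _ _ _
  G := smoothMat (g.coeff e) (g.smooth e he)
  Gi := (smoothMat (g.coeff e) (g.smooth e he))⁻¹
  G_herm := conjTranspose_eq_self fun z => (g.coeff_posDef he z.2).isHermitian
  G_mul := smoothMat_mul_inv _ _ fun z hz => (g.coeff_posDef he hz).isUnit
  h := smoothMat (fun z => H.mat (e.symm z)) (H.contDiffOn_mat_symm he)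
  hi := (smoothMat (fun z => H.mat (e.symm z)) (H.contDiffOn_mat_symm he))⁻¹
  h_herm := conjTranspose_eq_self fun z => (H.posDef _).isHermitian
  h_mul := smoothMat_mul_inv _ _ fun z _ => (H.posDef _).isUnit
  kahler i j k := smoothFun_ext fun z => by
    refine (dzDer_apply k (F := fun w => g.coeff e w i j) (fun w => rfl) z).trans ?_
    refine Eq.trans ?_ (dzDer_apply i (F := fun w => g.coeff e w k j) (fun w => rfl) z).symm
    exact hK e he z z.2 i j k

local notation "𝐒" => chartMetrics he g hK H

theorem eval_Gi (z : targetOpens e) : (𝐒).Gi.map (evalHom z) = (g.coeff e z)⁻¹ :=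
  map_eval_inv (𝐒).G_mul z

theorem eval_hi (z : targetOpens e) : (𝐒).hi.map (evalHom z) = (H.mat (e.symm z))⁻¹ :=
  map_eval_inv (𝐒).h_mul z

theorem eval_Gi_apply (z : targetOpens e) (i j : Fin n) :
    evalHom z ((𝐒).Gi j i) = g.invCoeff e z i j :=
  congrFun (congrFun (eval_Gi he g hK H z) j) i

theorem eval_A (z : targetOpens e) (k : Fin n) :
    ((𝐒).A k).map (evalHom z) = H.connForm (e.symm z) (coordVec e z k) := by
  rw [LocalMetrics.A, Matrix.map_mul, eval_hi, H.connForm_coordVec he z.2]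
  congr 1
  ext α β
  exact dzDer_apply k (F := fun w => H.mat (e.symm w) α β) (fun w => rfl) z

theorem eval_pair (z : targetOpens e) (B C : Fin n → Matrix (Fin r) (Fin r) (smoothFun _)) :
    evalHom z ((𝐒).pair B C) = pairForm (g.coeff e z)⁻¹ (H.mat (e.symm z)) (H.mat (e.symm z))⁻¹
      (fun k => (B k).map (evalHom z)) (fun k => (C k).map (evalHom z)) := by
  rw [← eval_Gi he g hK H z, ← eval_hi he g hK H z]
  simp only [LocalMetrics.pair, map_sum, map_mul]
  refine Finset.sum_congr rfl fun k _ => Finset.sum_congr rfl fun l _ => ?_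
  congr 1
  have htr : ∀ M : Matrix (Fin r) (Fin r) (smoothFun (targetOpens e)),
      evalHom z M.trace = (M.map (evalHom z)).trace := fun M => by simp [Matrix.trace]
  rw [htr]
  simp only [Matrix.map_mul]
  rfl

/-- Positivity makes the pairing real, so the real part taken in `normSqConnForm` loses nothing. -/
theorem eval_pair_A (z : targetOpens e) :
    evalHom z ((𝐒).pair (𝐒).A (𝐒).A) = (H.normSqConnForm g (e.symm z) : ℂ) := by
  have h := pairForm_nonneg (g.coeff_posDef he z.2).inv.posSemidef
    (H.posDef (e.symm z)).posSemidef (H.posDef (e.symm z)).inv.posSemidef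
    (fun k => H.connForm (e.symm z) (coordVec e z k))
  rw [eval_pair, BundleMetric.normSqConnForm_symm he g H z.2]
  simp only [eval_A]
  exact (Complex.eq_re_of_ofReal_le h)

theorem ricci_trace (hR : g.IsRicciFlat) (j k : Fin n) : (𝐒).db j ((𝐒).Th k).trace = 0 := by
  refine smoothFun_ext fun z => ?_
  have h := hR e he z z.2 k j
  rw [HermitianMetric.ricci] at h
  simp only [Matrix.trace, map_sum]
  rw [map_zero, ← neg_zero, ← h, ← Finset.sum_neg_distrib]
  refine Finset.sum_congr rfl fun i _ => ?_
  rw [HermitianMetric.curvature, neg_neg]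
  refine dzbarDer_apply j (fun w => ?_) z
  rw [HermitianMetric.christoffel]
  change evalHom w ((𝐒).Th k i i) = _
  rw [LocalMetrics.Th, Matrix.mul_apply, map_sum]
  refine Finset.sum_congr rfl fun p _ => ?_
  rw [map_mul, eval_Gi_apply, mul_comm]
  congr 1
  exact dzDer_apply k (F := fun w => g.coeff e w i p) (fun w => rfl) w

theorem hym_contraction (hH : H.IsHYM g) : ∃ c : ℂ,
    ∑ i, ∑ j, (𝐒).Gi j i • ((𝐒).A i).map ((𝐒).db j) = c • (1 : Matrix (Fin r) (Fin r) _) := by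
  obtain ⟨lam, hlam⟩ := hH
  -- The sign comes from `F_{i j̄} = -∂Aᵢ/∂z̄ⱼ`, the half from the factor `2` in `iLambda`.
  refine ⟨-lam / 2, map_eval_injective fun z => ?_⟩
  have h := hlam e he z z.2
  have h1 : ∀ i j, (((𝐒).A i).map ((𝐒).db j)).map (evalHom z) = -H.curvature e z i j := by
    intro i j
    ext α β
    refine (dzbarDer_apply j (f := (𝐒).A i α β)
      (F := fun w => H.connForm (e.symm w) (coordVec e w i) α β) (fun w => ?_) z).trans ?_
    · rw [← eval_A he g hK H w]; rfl
    · simp [BundleMetric.curvature]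
  ext α β
  have h2 := congrFun (congrFun h α) β
  simp only [HermitianMetric.iLambda, Matrix.sum_apply, Matrix.smul_apply, smul_eq_mul] at h2
  have h3 : ∀ i j, evalHom z ((((𝐒).A i).map ((𝐒).db j)) α β) = -H.curvature e z i j α β :=
    fun i j => congrFun (congrFun (h1 i j) α) β
  simp only [Matrix.map_apply, Matrix.sum_apply, Matrix.smul_apply, smul_eq_mul, map_sum, map_mul]
  simp only [Matrix.map_apply] at h3
  simp only [h3, eval_Gi_apply]
  have h4 : evalHom z ((-lam / 2) • (1 : Matrix (Fin r) (Fin r) (smoothFun (targetOpens e))) α β) =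
      (-lam / 2) * (1 : Matrix (Fin r) (Fin r) ℂ) α β := by
    change (-lam / 2) * evalHom z ((1 : Matrix (Fin r) (Fin r) (smoothFun (targetOpens e))) α β) = _
    refine congrArg (fun x => -lam / 2 * x) ?_
    by_cases hab : α = β
    · subst hab; simp
    · simp [hab]
  rw [h4]
  have h5 : (-lam / 2) * (1 : Matrix (Fin r) (Fin r) ℂ) α β =
      -(1 / 2) * (lam * (1 : Matrix (Fin r) (Fin r) ℂ) α β) := by ring
  rw [h5, ← h2]
  simp only [Finset.mul_sum]
  exact Finset.sum_congr rfl fun i _ => Finset.sum_congr rfl fun j _ => by ring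

/-- The Laplacian of the squared norm of the connection form, computed in the algebra of smooth
functions. -/
theorem laplacian_eq (z : targetOpens e) :
    g.laplacian (H.normSqConnForm g) e z =
      (2 * evalHom z (∑ i, ∑ j, (𝐒).Gi j i * (𝐒).d i ((𝐒).db j ((𝐒).pair (𝐒).A (𝐒).A)))).re := by
  rw [HermitianMetric.laplacian, HermitianMetric.iLambda]
  congr 1
  simp only [map_sum, map_mul, Finset.mul_sum, eval_Gi_apply, smul_eq_mul, mul_assoc]
  refine Finset.sum_congr rfl fun i _ => Finset.sum_congr rfl fun j _ => ?_
  congr 2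
  exact (dzDer_apply i (fun w => dzbarDer_apply j (fun u => eval_pair_A he g hK H u) w) z).symm

theorem contraction_nonneg (z : targetOpens e) (hR : g.IsRicciFlat) (hH : H.IsHYM g) :
    0 ≤ evalHom z (∑ i, ∑ j, (𝐒).Gi j i * (𝐒).d i ((𝐒).db j ((𝐒).pair (𝐒).A (𝐒).A))) := by
  obtain ⟨c, hc⟩ := hym_contraction he g hK H hH
  have hG := (g.coeff_posDef he z.2).inv.posSemidef
  have hq := pairForm_nonneg hG
    (H.posDef (e.symm z)).posSemidef (H.posDef (e.symm z)).inv.posSemidef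
  rw [(𝐒).bochner (ricci_trace he g hK H hR) hc, map_add]
  simp only [map_sum, map_mul, eval_pair]
  have hGi : ∀ i j, evalHom z ((𝐒).Gi i j) = (g.coeff e z)⁻¹ i j := fun i j =>
    congrFun (congrFun (eval_Gi he g hK H z) i) j
  simp only [hGi]
  refine add_nonneg ?_ (sum_sesq_nonneg _ hq hG _)
  -- In the `bar` term the indices appear in the opposite order, so the weight is the transpose of
  -- the inverse metric, still positive semidefinite.
  rw [Finset.sum_comm]
  exact sum_sesq_nonneg _ hq hG.transpose fun j k => ((𝐒).bar j (𝐒).A k).map (evalHom z)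

end Final

end KahlerHYM
end

theorem mainTheorem7 {n r : ℕ} {V : Type*} [TopologicalSpace V]
    [ChartedSpace (KahlerHYM.Cn n) V] [IsManifold 𝓘(ℂ, KahlerHYM.Cn n) ω V]
    (g : KahlerHYM.HermitianMetric n V) (hK : g.IsKahler) (hR : g.IsRicciFlat)
    (H : KahlerHYM.BundleMetric n r V) (hH : H.IsHYM g) :
    ∀ e ∈ IsManifold.maximalAtlas 𝓘(ℂ, KahlerHYM.Cn n) ω V, ∀ z ∈ e.target,
      -(g.laplacian (H.normSqConnForm g) e z) ≤ 0 := by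
  intro e he z hz
  have h := KahlerHYM.contraction_nonneg he g hK H ⟨z, hz⟩ hR hH
  rw [neg_nonpos, KahlerHYM.laplacian_eq he g hK H ⟨z, hz⟩]
  exact (Complex.nonneg_iff.mp (mul_nonneg (by norm_num) h)).1
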